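/- Let $A$ be an arbitrary alphabet and let $A^*$ be the free monoid on $A$, with empty word $1$. For $w\in A^*$ let $w^{(+)}$ be its palindromic closure, the unique shortest palindrome having $w$ as a prefix. Let $\mathrm{Pal}:A^*\to A^*$ be the map defined by $\mathrm{Pal}(1)=1$ and $\mathrm{Pal}(wa)=(\mathrm{Pal}(w)a)^{(+)}$ for $w\in A^*$, $a\in A$. For a language $L\subset A^*$ and $u\in A^*$, let $u^{-1}L=\{v\in A^*\mid uv\in L\}$. A nonempty residual $u^{-1}L$ is called special if $u=1$, or $u\in L$, or $u^{-1}L$ contains two words beginning with different letters. The minimal compact automaton of $L$ has the special residuals of $L$ as states, $L$ as initial state, and the $u^{-1}L$ with $u\in L$ as terminal states. Its transitions are the triples $(p,v,q)$ with $p,q$ states and $v$ a nonempty word such that, for some $u\in A^*$, $p=u^{-1}L$, $q=(uv)^{-1}L$, and there is no factorization $v=v'v''$ with $v',v''$ nonempty such that $(uv')^{-1}L$ is a special residual. For $u\in A^*$ let $\mathcal S_c(u)$ denote the minimal compact automaton of the set of all suffixes of $\mathrm{Pal}(u)$ (including the empty one). Let $u\in A^*$ be of length $n$, and for any $a\in A$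 let $p_a(u)$ be the position (counted from $1$) of the rightmost occurrence of $a$ in $u$, with $p_a(u)=0$ when $a$ does not occur in $u$. Then the number of states of $\mathcal S_c(u)$ is $n+1$, and its number of transitions is $\sum_{a\in A}p_a(u)$ (a sum with finitely many nonzero terms). -/

import Mathlib

/-!
Words over an alphabet `A` are lists `List A`; the empty word `1` is `[]`.
-/

namespace PalAutomaton

universe u v

/-! ### Iterated palindromic closure -/

/-- The palindromic closure of `w`: if `w = y z` with `z` the longest palindromic suffix of `w`,
it is `y z ỹ`. By `palClosure_eq_iff` below, this is the unique
shortest palindrome having `w` as a prefix. -/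
def palClosure {A : Type u} [DecidableEq A] : List A → List A
  | [] => []
  | a :: w => if (a :: w).reverse = a :: w then a :: w else a :: (palClosure w ++ [a])

/-- `p` is a shortest palindrome among those having `w` as a prefix. -/
def IsShortestPalExtension {A : Type u} (w p : List A) : Prop :=
  p.reverse = p ∧ w <+: p ∧ ∀ q : List A, q.reverse = q → w <+: q → p.length ≤ q.length

theorem reverse_palClosure {A : Type u} [DecidableEq A] (w : List A) :
    (palClosure w).reverse = palClosure w := by
  induction w with
  | nil => rfl
  | cons a w ih =>
    unfold palClosure
    split_ifs with h
    · exact h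
    · simp [ih]

theorem prefix_palClosure {A : Type u} [DecidableEq A] (w : List A) : w <+: palClosure w := by
  induction w with
  | nil => simp [palClosure]
  | cons a w ih =>
    unfold palClosure
    split_ifs with h
    · exact List.prefix_rfl
    · rw [List.cons_prefix_cons]
      exact ⟨rfl, ih.trans (List.prefix_append _ _)⟩

theorem palClosure_minimal {A : Type u} [DecidableEq A] (w : List A) :
    ∀ q : List A, q.reverse = q → w <+: q → (palClosure w).length ≤ q.length ∧
      (q.length ≤ (palClosure w).length → q = palClosure w) := by
  induction w with
  | nil =>
    intro q _ _
    simp [palClosure]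
  | cons a w ih =>
    intro q hq hw
    unfold palClosure
    split_ifs with h
    · exact ⟨hw.length_le, fun hl => (hw.eq_of_length_le hl).symm⟩
    · obtain ⟨t, rfl⟩ := hw
      rw [List.cons_append] at hq ⊢
      rcases List.eq_nil_or_concat (w ++ t) with h0 | ⟨m, b, hm⟩
      · exfalso
        have : w = [] := (List.append_eq_nil_iff.mp h0).1
        subst this
        simp at h
      · rw [List.concat_eq_append] at hm
        rw [hm] at hq ⊢
        simp only [List.reverse_cons, List.reverse_append, List.reverse_nil, List.nil_append,
          List.cons_append, List.cons.injEq] at hq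
        obtain ⟨hba, hq⟩ := hq
        subst hba
        have hmr : m.reverse = m := List.append_cancel_right hq
        have hwm : w <+: m := by
          have hw' : w <+: m ++ [b] := ⟨t, hm⟩
          rcases List.prefix_concat_iff.mp hw' with h1 | h1
          · exfalso
            apply h
            rw [h1]
            simp [hmr]
          · exact h1
        obtain ⟨h1, h2⟩ := ih m hmr hwm
        refine ⟨by simpa using h1, fun hl => ?_⟩
        rw [h2 (by simpa using hl)]

theorem palClosure_eq_iff {A : Type u} [DecidableEq A] (w p : List A) :
    palClosure w = p ↔ IsShortestPalExtension w p := by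
  constructor
  · rintro rfl
    exact ⟨reverse_palClosure w, prefix_palClosure w,
      fun q hq hw => (palClosure_minimal w q hq hw).1⟩
  · rintro ⟨hp, hw, hmin⟩
    exact ((palClosure_minimal w p hp hw).2
      (hmin _ (reverse_palClosure w) (prefix_palClosure w))).symm

/-- The iterated palindromic closure: `Pal 1 = 1` and `Pal (w a) = (Pal w a)^(+)`. -/
def Pal {A : Type u} [DecidableEq A] (w : List A) : List A :=
  w.foldl (fun p a => palClosure (p ++ [a])) []

theorem Pal_nil {A : Type u} [DecidableEq A] : Pal ([] : List A) = [] := rfl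

theorem Pal_append_singleton {A : Type u} [DecidableEq A] (w : List A) (a : A) :
    Pal (w ++ [a]) = palClosure (Pal w ++ [a]) := by
  simp [Pal]

/-! ### Compact automata -/

/-- A compact automaton `(Q, E, I, T)` over `A`, with `E ⊆ Q × A⁺ × Q` and `I, T ⊆ Q`. -/
structure CompactAutomaton (A : Type u) (Q : Type v) where
  edges : Set (Q × List A × Q)
  label_ne_nil : ∀ e ∈ edges, e.2.1 ≠ []
  initial : Set Q
  terminal : Set Q

/-- The number of states. -/
noncomputable def CompactAutomaton.numStates {A : Type u} {Q : Type v}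
    (_M : CompactAutomaton A Q) : ℕ∞ :=
  ENat.card Q

/-- The number of transitions (edges). -/
noncomputable def CompactAutomaton.numTransitions {A : Type u} {Q : Type v}
    (M : CompactAutomaton A Q) : ℕ∞ :=
  M.edges.encard

/-- `R` is a special residual of `L`: a nonempty residual `u⁻¹L = {v | u v ∈ L}` such that `u = 1`,
or `u ∈ L`, or `u⁻¹L` contains two words beginning with different letters. -/
def IsSpecialResidual {A : Type u} (L R : Language A) : Prop :=
  (∃ v, v ∈ R) ∧ ∃ u : List A, R = L.leftQuotient u ∧
    (u = [] ∨ u ∈ L ∨ ∃ (a b : A) (v w : List A), a ≠ b ∧ a :: v ∈ R ∧ b :: w ∈ R)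

/-- The minimal compact automaton of `L`: its states are the special residuals of `L`, its initial
state is `L`, its terminal states are the `u⁻¹L` with `u ∈ L`, and its edges are
the `(u⁻¹L, v, (uv)⁻¹L)` with `v` nonempty such that there is no factorization `v = v'v''` with
`v', v''` nonempty and `(uv')⁻¹L` a special residual. -/
def minimalCompactAutomaton {A : Type u} (L : Language A) :
    CompactAutomaton A {R : Language A // IsSpecialResidual L R} where
  edges := {e | e.2.1 ≠ [] ∧ ∃ u : List A,
    e.1.1 = L.leftQuotient u ∧ e.2.2.1 = L.leftQuotient (u ++ e.2.1) ∧
    ¬ ∃ v' v'' : List A, v' ≠ [] ∧ v'' ≠ [] ∧ e.2.1 = v' ++ v'' ∧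
      IsSpecialResidual L (L.leftQuotient (u ++ v'))}
  label_ne_nil := fun _ he => he.1
  initial := {R | R.1 = L}
  terminal := {R | ∃ u : List A, u ∈ L ∧ R.1 = L.leftQuotient u}

/-- The language of all suffixes of `w` (including `1` and `w`). -/
def suffixLanguage {A : Type u} (w : List A) : Language A :=
  {s | s <:+ w}

/-- `S_c(u)`: the minimal compact automaton of the set of suffixes of `Pal u`. -/
def compactSuffixAutomaton {A : Type u} [DecidableEq A] (w : List A) :
    CompactAutomaton A {R : Language A // IsSpecialResidual (suffixLanguage (Pal w)) R} :=
  minimalCompactAutomaton (suffixLanguage (Pal w))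

/-! ### Position of the rightmost occurrence -/

/-- The position (counted from `1`) of the rightmost occurrence of `a` in `w`, and `0` if `a` does
not occur in `w`. -/
def lastPos {A : Type u} [DecidableEq A] (a : A) (w : List A) : ℕ :=
  {j ∈ Finset.range w.length | w[j]? = some a}.sup (fun j => j + 1)

theorem lastPos_eq_zero {A : Type u} [DecidableEq A] {a : A} {w : List A} (h : a ∉ w) :
    lastPos a w = 0 := by
  unfold lastPos
  rw [Finset.filter_false_of_mem]
  · rfl
  · intro j _ hj
    exact h (List.mem_of_getElem? hj)

theorem finite_support_lastPos {A : Type u} [DecidableEq A] (w : List A) :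
    (Function.support fun a => lastPos a w).Finite := by
  refine w.toFinset.finite_toSet.subset fun a ha => ?_
  by_contra h
  exact ha (lastPos_eq_zero (by simpa using h))

end PalAutomaton

/-!
Call a palindrome `P` *epicentral* if every right special factor `x` of `P` is, for each letter `c`
that follows it in `P`, a suffix of a palindromic prefix of `P` followed by `c`. This passes from
`P` to `(P a)^(+) = z Q z̃`, where `z Q = P a` and `Q` is the longest palindromic suffix of `P a`:
the word `Q` is not a factor of `P`, so a factor of the closure either is a factor of `P` or
contains its only occurrence of `Q`, and in the second case it can be right special only by ending
before the last letter of `Q`. Hence `Pal w` is epicentral.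

Each suffix `x` of an epicentral word extends, at all of its occurrences, to the left into the same
palindromic suffix. So the special residuals of the suffixes of `Pal w` are the residuals by its
palindromic prefixes, which are the words `Pal v` for the `n + 1` prefixes `v` of `w`. In any
minimal compact automaton the edges leaving a state are told apart by the first letters of their
labels, and `Pal v` is followed by `a` somewhere in `Pal w` exactly when `a` occurs in `w` after
`v`, i.e. when `|v|` is less than the rightmost position of `a`.
-/

namespace PalAutomaton

variable {A : Type*}

section Palindrome

variable {P x : List A}

theorem reverse_prefix_iff_suffix (hP : P.reverse = P) : x.reverse <+: P ↔ x <:+ P := by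
  conv_lhs => rw [← hP, List.reverse_prefix]

theorem reverse_infix_iff_infix (hP : P.reverse = P) : x.reverse <:+: P ↔ x <:+: P := by
  conv_lhs => rw [← hP, List.reverse_infix]

theorem prefix_iff_suffix_of_reverse_eq (hx : x.reverse = x) (hP : P.reverse = P) :
    x <+: P ↔ x <:+ P := by
  rw [← reverse_prefix_iff_suffix hP, hx]

theorem reverse_eq_of_prefix_of_suffix (hP : P.reverse = P) (hpre : x <+: P) (hsuf : x <:+ P) :
    x.reverse = x := by
  have hrev : x.reverse <+: P := (reverse_prefix_iff_suffix hP).mpr hsuf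
  exact (List.prefix_of_prefix_length_le hrev hpre (by simp)).eq_of_length (by simp)

end Palindrome

section Epicentral

/-- The two properties of the epicentral words `Pal w` that survive the step `P ↦ (P a)^(+)`: such
a word is a palindrome, and whenever a factor `x` is followed in it by two different letters `c` and
`d`, some palindromic prefix ends with `x` and is followed by `c`. -/
structure IsEpicentral (P : List A) : Prop where
  reverse_eq : P.reverse = P
  exists_pal_prefix_of_special : ∀ ⦃x : List A⦄ ⦃c d : A⦄, c ≠ d → x ++ [c] <:+: P →
    x ++ [d] <:+: P → ∃ T : List A, T.reverse = T ∧ x <:+ T ∧ T ++ [c] <+: P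

theorem isEpicentral_nil : IsEpicentral ([] : List A) where
  reverse_eq := rfl
  exists_pal_prefix_of_special x c d _ hc _ := by simp at hc

namespace IsEpicentral

variable {P Q x : List A} {a c d : A}

theorem suffix_of_special (h : IsEpicentral P) (hcd : c ≠ d) (hc : x ++ [c] <:+: P)
    (hd : x ++ [d] <:+: P) : x <:+ P := by
  obtain ⟨T, hT, hxT, hTc⟩ := h.exists_pal_prefix_of_special hcd hc hd
  have hTP : T <+: P := (List.prefix_append T [c]).trans hTc
  exact hxT.trans ((prefix_iff_suffix_of_reverse_eq hT h.reverse_eq).mp hTP)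

theorem prefix_of_left_special (h : IsEpicentral P) (hcd : c ≠ d) (hc : c :: x <:+: P)
    (hd : d :: x <:+: P) : x <+: P := by
  rw [← reverse_infix_iff_infix h.reverse_eq, List.reverse_cons] at hc hd
  rw [← x.reverse_reverse, reverse_prefix_iff_suffix h.reverse_eq]
  exact h.suffix_of_special hcd hc hd

theorem exists_common_pal_left_extension (h : IsEpicentral P) (hx : x <:+ P) :
    ∃ T : List A, T.reverse = T ∧ T <:+ P ∧ x <:+ T ∧
      ∀ α : List A, α ++ x <+: P → T <:+ α ++ x := by
  induction hk : P.length - x.length generalizing x with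
  | zero =>
    obtain rfl := hx.eq_of_length_le (by omega)
    exact ⟨x, h.reverse_eq, hx, hx, fun α _ => List.suffix_append α x⟩
  | succ k ih =>
    by_cases hpal : x.reverse = x
    · exact ⟨x, hpal, hx, List.suffix_rfl, fun α _ => List.suffix_append α x⟩
    have hpre : ¬ x <+: P := fun hp => hpal (reverse_eq_of_prefix_of_suffix h.reverse_eq hp hx)
    obtain ⟨c, hcx⟩ : ∃ c, c :: x <:+ P := by
      obtain ⟨t, rfl⟩ := hx
      rcases List.eq_nil_or_concat' t with rfl | ⟨t, c, rfl⟩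
      · exact absurd List.prefix_rfl hpre
      · exact ⟨c, t, by simp⟩
    obtain ⟨T, hT, hTP, hxT, hext⟩ := ih hcx (by rw [List.length_cons]; omega)
    refine ⟨T, hT, hTP, (List.suffix_cons c x).trans hxT, fun α hα => ?_⟩
    rcases List.eq_nil_or_concat' α with rfl | ⟨α, d, rfl⟩
    · exact absurd hα hpre
    rw [List.append_assoc, List.singleton_append] at hα ⊢
    have hdx : d :: x <:+: P := (List.suffix_append α (d :: x)).isInfix.trans hα.isInfix
    obtain rfl : c = d := by
      by_contra hcd
      exact hpre (h.prefix_of_left_special hcd hcx.isInfix hdx)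
    exact hext α hα

theorem exists_pal_prefix_of_suffix (h : IsEpicentral P) (hx : x <:+ P)
    (hc : x ++ [c] <:+: P) : ∃ T : List A, T.reverse = T ∧ x <:+ T ∧ T ++ [c] <+: P := by
  obtain ⟨T, hT, hTP, hxT, hext⟩ := h.exists_common_pal_left_extension hx
  have hTc : T ++ [c] <:+: P := by
    obtain ⟨α, β, hP⟩ := hc
    obtain ⟨s, hs⟩ := hext α ⟨[c] ++ β, by simpa using hP⟩
    exact ⟨s, β, by rw [← hP, ← List.append_assoc, hs, List.append_assoc α]⟩
  obtain ⟨r, hr⟩ := (prefix_iff_suffix_of_reverse_eq hT h.reverse_eq).mpr hTP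
  cases r with
  | nil =>
    have hlen := hTc.length_le
    rw [← hr] at hlen
    simp at hlen
  | cons e r =>
    have hTe : T ++ [e] <+: P := ⟨r, by simpa using hr⟩
    by_cases hce : c = e
    · exact ⟨T, hT, hxT, hce ▸ hTe⟩
    · obtain ⟨U, hU, hTU, hUc⟩ := h.exists_pal_prefix_of_special hce hTc hTe.isInfix
      exact ⟨U, hU, hxT.trans hTU, hUc⟩

theorem not_infix_of_longest_pal_suffix (h : IsEpicentral P) (hQ : Q.reverse = Q)
    (hQP : Q <:+ P ++ [a])
    (hmax : ∀ S : List A, S.reverse = S → S <:+ P ++ [a] → S.length ≤ Q.length) :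
    ¬ Q <:+: P := by
  intro hinfix
  rcases List.suffix_concat_iff.mp hQP with rfl | ⟨x, rfl, hx⟩
  · simpa using hmax [a] rfl (List.suffix_append P [a])
  obtain ⟨T, hT, hxT, hTa⟩ := h.exists_pal_prefix_of_suffix hx hinfix
  have haT : a :: T <:+ P := by
    rw [← reverse_prefix_iff_suffix h.reverse_eq, List.reverse_cons, hT]
    exact hTa
  have hlonger := hmax (a :: T ++ [a]) (by simp [hT])
    (List.suffix_concat_iff.mpr (Or.inr ⟨a :: T, rfl, haT⟩))
  have hxT_length := hxT.length_le
  simp only [List.length_append, List.length_cons, List.length_nil] at hlonger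
  omega

end IsEpicentral

end Epicentral

section Closure

variable {P Q z x α β : List A} {a c d : A}

theorem infix_or_eq_append_of_pal_suffix (hP : P.reverse = P) (hQ : Q.reverse = Q)
    (hzQ : z ++ Q = P ++ [a]) (hx : α ++ x ++ β = z ++ Q ++ z.reverse) :
    x <:+: P ∨ ∃ x₁ x₂, x = x₁ ++ Q ++ x₂ ∧ z = α ++ x₁ := by
  have hleft : z ++ Q ++ z.reverse = P ++ a :: z.reverse := by simp [hzQ]
  have hright : z ++ Q ++ z.reverse = z ++ a :: P := by
    have hrev := congrArg List.reverse hleft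
    simpa [hP, hQ] using hrev
  rcases lt_or_ge z.length β.length with hβ | hβ
  · have hlen := congrArg List.length (hx.trans hleft)
    have hαx : α ++ x <+: P := by
      refine List.prefix_of_prefix_length_le ⟨β, hx⟩ ⟨_, hleft.symm⟩ ?_
      simp only [List.length_append, List.length_cons, List.length_reverse] at hlen ⊢
      omega
    exact Or.inl ((List.suffix_append α x).isInfix.trans hαx.isInfix)
  rcases lt_or_ge z.length α.length with hα | hα
  · have hlen := congrArg List.length (hx.trans hright)
    have hxβ : x ++ β <:+ P := by
      refine List.suffix_of_suffix_length_le ⟨α, by rw [← List.append_assoc, hx]⟩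
        ⟨z ++ [a], by rw [hright, List.append_assoc, List.singleton_append]⟩ ?_
      simp only [List.length_append, List.length_cons] at hlen ⊢
      omega
    exact Or.inl ((List.prefix_append x β).isInfix.trans hxβ.isInfix)
  · obtain ⟨x₁, hx₁⟩ : α <+: z :=
      List.prefix_of_prefix_length_le ⟨x ++ β, by rw [← List.append_assoc, hx]⟩
        ⟨Q ++ z.reverse, by rw [← List.append_assoc]⟩ hα
    obtain ⟨x₂, hx₂⟩ : β <:+ z.reverse :=
      List.suffix_of_suffix_length_le ⟨α ++ x, hx⟩ ⟨z ++ Q, rfl⟩ (by simpa using hβ)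
    refine Or.inr ⟨x₁, x₂, ?_, hx₁.symm⟩
    have hcancel : α ++ x ++ β = α ++ (x₁ ++ Q ++ x₂) ++ β := by
      rw [hx, ← hx₂, ← hx₁]
      simp only [List.append_assoc]
    exact List.append_cancel_left (List.append_cancel_right hcancel)

theorem eq_of_append_eq_of_pal_suffix (hP : P.reverse = P) (hQ : Q.reverse = Q)
    (hzQ : z ++ Q = P ++ [a]) (hQP : ¬ Q <:+: P)
    (hoccurs : α ++ Q ++ β = z ++ Q ++ z.reverse) : α = z := by
  obtain ⟨x₁, x₂, hx, rfl⟩ :=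
    (infix_or_eq_append_of_pal_suffix hP hQ hzQ hoccurs).resolve_left hQP
  have hlen := congrArg List.length hx
  simp only [List.length_append] at hlen
  obtain rfl : x₁ = [] := List.length_eq_zero_iff.mp (by omega)
  rw [List.append_nil]

theorem suffix_and_eq_of_special_of_not_infix (hP : P.reverse = P) (hQ : Q.reverse = Q)
    (hzQ : z ++ Q = P ++ [a]) (hQP : ¬ Q <:+: P) (hcd : c ≠ d)
    (hc : x ++ [c] <:+: z ++ Q ++ z.reverse) (hd : x ++ [d] <:+: z ++ Q ++ z.reverse)
    (hcP : ¬ x ++ [c] <:+: P) : x <:+ P ∧ c = a := by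
  obtain ⟨α, β, hαβ⟩ := hc
  obtain ⟨x₁, x₂, hx, hz⟩ :=
    (infix_or_eq_append_of_pal_suffix hP hQ hzQ hαβ).resolve_left hcP
  rcases List.eq_nil_or_concat' x₂ with rfl | ⟨x₂, e, rfl⟩
  · have hPa : (α ++ x) ++ [c] = P ++ [a] := by
      rw [← hzQ, hz, List.append_assoc, hx]
      simp only [List.append_nil, List.append_assoc]
    obtain ⟨hαx, hca⟩ := List.append_singleton_inj.mp hPa
    exact ⟨⟨α, hαx⟩, hca⟩
  · exfalso
    -- Now `x` contains `Q`, so it occurs only once and cannot be followed by both `c` and `d`.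
    obtain ⟨hx, -⟩ : x = x₁ ++ Q ++ x₂ ∧ c = e := by
      rwa [← List.append_assoc, List.append_singleton_inj] at hx
    obtain ⟨α', β', hαβ'⟩ := hd
    have hα' : α' ++ x₁ = α ++ x₁ := by
      rw [← hz]
      refine eq_of_append_eq_of_pal_suffix hP hQ hzQ hQP (β := x₂ ++ [d] ++ β') ?_
      rw [← hαβ', hx]
      simp only [List.append_assoc]
    rw [List.append_cancel_right hα', ← hαβ] at hαβ'
    simp only [List.append_assoc, List.append_cancel_left_eq, List.cons_append,
      List.cons.injEq] at hαβ'
    exact hcd hαβ'.1.symm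

variable [DecidableEq A]

theorem exists_longest_pal_suffix_palClosure_eq (w : List A) :
    ∃ z Q : List A, z ++ Q = w ∧ Q.reverse = Q ∧ palClosure w = z ++ Q ++ z.reverse ∧
      ∀ S : List A, S.reverse = S → S <:+ w → S.length ≤ Q.length := by
  induction w with
  | nil => exact ⟨[], [], by simp [palClosure]⟩
  | cons a w ih =>
    by_cases hpal : (a :: w).reverse = a :: w
    · exact ⟨[], a :: w, rfl, hpal, by simp [palClosure, hpal], fun S _ hS => hS.length_le⟩
    · obtain ⟨z, Q, rfl, hQ, hclosure, hmax⟩ := ih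
      refine ⟨a :: z, Q, rfl, hQ, ?_, fun S hS hSw => ?_⟩
      · rw [palClosure, if_neg hpal, hclosure]
        simp
      · rcases List.suffix_cons_iff.mp hSw with rfl | hSw
        · exact absurd hS hpal
        · exact hmax S hS hSw

theorem IsEpicentral.palClosure_append_singleton (h : IsEpicentral P) (a : A) :
    IsEpicentral (palClosure (P ++ [a])) := by
  refine ⟨reverse_palClosure _, fun x c d hcd hc hd => ?_⟩
  have hprefix : P ++ [a] <+: palClosure (P ++ [a]) := prefix_palClosure _
  obtain ⟨z, Q, hzQ, hQ, hclosure, hmax⟩ := exists_longest_pal_suffix_palClosure_eq (P ++ [a])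
  have hQP : ¬ Q <:+: P := h.not_infix_of_longest_pal_suffix hQ ⟨z, hzQ⟩ hmax
  rw [hclosure] at hc hd
  by_cases hcP : x ++ [c] <:+: P
  · obtain ⟨T, hT, hxT, hTc⟩ : ∃ T : List A, T.reverse = T ∧ x <:+ T ∧ T ++ [c] <+: P := by
      by_cases hdP : x ++ [d] <:+: P
      · exact h.exists_pal_prefix_of_special hcd hcP hdP
      · exact h.exists_pal_prefix_of_suffix (suffix_and_eq_of_special_of_not_infix h.reverse_eq hQ
          hzQ hQP hcd.symm hd hc hdP).1 hcP
    exact ⟨T, hT, hxT, hTc.trans ((List.prefix_append P [a]).trans hprefix)⟩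
  · obtain ⟨hxP, rfl⟩ :=
      suffix_and_eq_of_special_of_not_infix h.reverse_eq hQ hzQ hQP hcd hc hd hcP
    exact ⟨P, h.reverse_eq, hxP, hprefix⟩

end Closure

section Pal

variable [DecidableEq A] {v v' w T : List A} {a : A}

theorem isEpicentral_Pal (w : List A) : IsEpicentral (Pal w) := by
  induction w using List.reverseRecOn with
  | nil => exact isEpicentral_nil
  | append_singleton w a ih =>
    rw [Pal_append_singleton]
    exact ih.palClosure_append_singleton a

theorem Pal_append_prefix_Pal_append_singleton (w : List A) (a : A) :
    Pal w ++ [a] <+: Pal (w ++ [a]) := by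
  rw [Pal_append_singleton]
  exact prefix_palClosure _

theorem Pal_prefix_Pal (h : v <+: w) : Pal v <+: Pal w := by
  induction w using List.reverseRecOn with
  | nil => rw [List.prefix_nil.mp h]
  | append_singleton w a ih =>
    rcases List.prefix_concat_iff.mp h with rfl | h
    · exact List.prefix_rfl
    · exact (ih h).trans ((List.prefix_append _ _).trans
        (Pal_append_prefix_Pal_append_singleton w a))

theorem Pal_append_prefix_Pal (h : v ++ [a] <+: w) : Pal v ++ [a] <+: Pal w :=
  (Pal_append_prefix_Pal_append_singleton v a).trans (Pal_prefix_Pal h)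

theorem append_prefix_of_Pal_append_prefix (hv : v <+: w) (h : Pal v ++ [a] <+: Pal w) :
    v ++ [a] <+: w := by
  obtain ⟨s, rfl⟩ := hv
  cases s with
  | nil =>
    have hlen := h.length_le
    simp at hlen
  | cons b s =>
    have hvb : v ++ [b] <+: v ++ b :: s := ⟨s, by simp⟩
    have heq : Pal v ++ [a] = Pal v ++ [b] :=
      (List.prefix_of_prefix_length_le h (Pal_append_prefix_Pal hvb) (by simp)).eq_of_length
        (by simp)
    rwa [(List.append_singleton_inj.mp heq).2]

theorem prefix_of_length_Pal_le (hv : v <+: w) (hv' : v' <+: w)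
    (h : (Pal v).length ≤ (Pal v').length) : v <+: v' := by
  rcases List.prefix_or_prefix_of_prefix hv hv' with hvv' | ⟨s, rfl⟩
  · exact hvv'
  · cases s with
    | nil => simp
    | cons b s =>
      have hlen := (Pal_append_prefix_Pal (v := v') (w := v' ++ b :: s) (a := b)
        ⟨s, by simp⟩).length_le
      rw [List.length_append, List.length_singleton] at hlen
      omega

theorem exists_prefix_Pal_eq (hT : T.reverse = T) (h : T <+: Pal w) :
    ∃ v, v <+: w ∧ Pal v = T := by
  induction w using List.reverseRecOn with
  | nil => exact ⟨[], List.prefix_rfl, (List.prefix_nil.mp h).symm⟩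
  | append_singleton w a ih =>
    rcases le_or_gt T.length (Pal w).length with hlen | hlen
    · obtain ⟨v, hv, rfl⟩ := ih (List.prefix_of_prefix_length_le h
        (Pal_prefix_Pal (List.prefix_append w [a])) hlen)
      exact ⟨v, hv.trans (List.prefix_append w [a]), rfl⟩
    · have hwT : Pal w ++ [a] <+: T :=
        List.prefix_of_prefix_length_le (Pal_append_prefix_Pal_append_singleton w a) h
          (by simpa using hlen)
      rw [Pal_append_singleton] at h
      refine ⟨w ++ [a], List.prefix_rfl, ?_⟩
      rw [Pal_append_singleton]
      exact ((palClosure_minimal _ T hT hwT).2 h.length_le).symm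

theorem lt_lastPos_iff {k : ℕ} :
    k < lastPos a w ↔ ∃ v, k ≤ v.length ∧ v ++ [a] <+: w := by
  simp only [lastPos, Finset.lt_sup_iff, Finset.mem_filter, Finset.mem_range, Order.lt_add_one_iff]
  constructor
  · rintro ⟨j, ⟨hj, hja⟩, hkj⟩
    obtain rfl : w[j] = a := by simpa [hj] using hja
    refine ⟨w.take j, by simp [hkj, hj.le], ?_⟩
    rw [← List.take_succ_eq_append_getElem hj]
    exact List.take_prefix _ _
  · rintro ⟨v, hkv, s, rfl⟩
    exact ⟨v.length, by simp, hkv⟩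

theorem lastPos_le_length (a : A) (w : List A) : lastPos a w ≤ w.length := by
  by_contra! hlt
  obtain ⟨v, hv, hva⟩ := lt_lastPos_iff.mp hlt
  have hlen := hva.length_le
  rw [List.length_append, List.length_singleton] at hlen
  omega

theorem Pal_append_infix_Pal_iff (hv : v <+: w) :
    Pal v ++ [a] <:+: Pal w ↔ v.length < lastPos a w := by
  rw [lt_lastPos_iff]
  constructor
  · intro hva
    have hsuffix : Pal v <:+ Pal w := (prefix_iff_suffix_of_reverse_eq
      (isEpicentral_Pal v).reverse_eq (isEpicentral_Pal w).reverse_eq).mp (Pal_prefix_Pal hv)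
    obtain ⟨T, hT, hvT, hTa⟩ := (isEpicentral_Pal w).exists_pal_prefix_of_suffix hsuffix hva
    obtain ⟨v', hv', rfl⟩ := exists_prefix_Pal_eq hT ((List.prefix_append _ _).trans hTa)
    exact ⟨v', (prefix_of_length_Pal_le hv hv' hvT.length_le).length_le,
      append_prefix_of_Pal_append_prefix hv' hTa⟩
  · rintro ⟨v', hlen, hv'a⟩
    have hvv' : v <+: v' :=
      List.prefix_of_prefix_length_le hv ((List.prefix_append _ _).trans hv'a) hlen
    obtain ⟨s, hs⟩ : Pal v <:+ Pal v' := (prefix_iff_suffix_of_reverse_eq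
      (isEpicentral_Pal v).reverse_eq (isEpicentral_Pal v').reverse_eq).mp (Pal_prefix_Pal hvv')
    have hva : Pal v ++ [a] <:+ Pal v' ++ [a] := ⟨s, by rw [← List.append_assoc, hs]⟩
    exact hva.isInfix.trans (Pal_append_prefix_Pal hv'a).isInfix

end Pal

section MinimalCompactAutomaton

/-- The states of the minimal compact automaton of `L`. -/
abbrev SpecialResidual (L : Language A) : Type _ :=
  {R : Language A // IsSpecialResidual L R}

/-- The data that determine an edge of a minimal compact automaton; labels of edges are nonempty,
so that `head?` never returns `none` on them. -/
def originAndFirstLetter {Q : Type*} (e : Q × List A × Q) : Q × Option A :=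
  (e.1, e.2.1.head?)

variable {L R : Language A} {p q q' : SpecialResidual L} {v v' : List A} {c : A}

theorem IsSpecialResidual.leftQuotient_of_mem (hR : IsSpecialResidual L R) (hv : v ∈ R) :
    IsSpecialResidual L (R.leftQuotient v) := by
  obtain ⟨-, u, rfl, -⟩ := hR
  exact ⟨⟨[], by simpa using hv⟩, u ++ v, (Language.leftQuotient_append L u v).symm,
    Or.inr (Or.inl hv)⟩

theorem IsSpecialResidual.leftQuotient_of_branch (hR : IsSpecialResidual L R) {g s t : List A}
    {a b : A} (hab : a ≠ b) (ha : g ++ a :: s ∈ R) (hb : g ++ b :: t ∈ R) :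
    IsSpecialResidual L (R.leftQuotient g) := by
  obtain ⟨-, u, rfl, -⟩ := hR
  exact ⟨⟨_, ha⟩, u ++ g, (Language.leftQuotient_append L u g).symm,
    Or.inr (Or.inr ⟨a, b, s, t, hab, ha, hb⟩)⟩

theorem mem_edges_minimalCompactAutomaton_iff :
    (p, v, q) ∈ (minimalCompactAutomaton L).edges ↔ v ≠ [] ∧ q.1 = p.1.leftQuotient v ∧
      ∀ v' v'' : List A, v' ≠ [] → v'' ≠ [] → v = v' ++ v'' →
        ¬ IsSpecialResidual L (p.1.leftQuotient v') := by
  have hunfold (u : List A) (hp : p.1 = L.leftQuotient u) (v' : List A) :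
      L.leftQuotient (u ++ v') = p.1.leftQuotient v' := by
    rw [Language.leftQuotient_append, hp]
  constructor
  · rintro ⟨hv, u, hp, hq, hmin⟩
    simp only [hunfold u hp] at hq hmin
    exact ⟨hv, hq, fun v' v'' hv' hv'' heq hs => hmin ⟨v', v'', hv', hv'', heq, hs⟩⟩
  · rintro ⟨hv, hq, hmin⟩
    obtain ⟨-, u, hp, -⟩ := p.2
    refine ⟨hv, u, hp, by rw [hunfold u hp, hq], ?_⟩
    rintro ⟨v', v'', hv', hv'', heq, hs⟩
    exact hmin v' v'' hv' hv'' heq (hunfold u hp v' ▸ hs)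

theorem label_mem_of_mem_edges (h : (p, v, q) ∈ (minimalCompactAutomaton L).edges) :
    ∃ t, v ++ t ∈ p.1 := by
  obtain ⟨t, ht⟩ := q.2.1
  rw [(mem_edges_minimalCompactAutomaton_iff.mp h).2.1] at ht
  exact ⟨t, ht⟩

theorem label_prefix_label_of_mem_edges
    (h : (p, c :: v, q) ∈ (minimalCompactAutomaton L).edges)
    (h' : (p, c :: v', q') ∈ (minimalCompactAutomaton L).edges) : v <+: v' := by
  suffices hprefix : ∀ g, g <+: v → g <+: v' from hprefix v List.prefix_rfl
  intro g
  induction g using List.reverseRecOn with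
  | nil => exact fun _ => List.nil_prefix
  | append_singleton g a ih =>
    rintro ⟨s, hs⟩
    obtain rfl : v = g ++ a :: s := by simp [← hs]
    obtain ⟨t, rfl⟩ := ih (List.prefix_append _ _)
    have hg : ¬ IsSpecialResidual L (p.1.leftQuotient (c :: g)) :=
      (mem_edges_minimalCompactAutomaton_iff.mp h).2.2 (c :: g) (a :: s) (by simp) (by simp) rfl
    cases t with
    | nil =>
      rw [List.append_nil] at h'
      rw [← (mem_edges_minimalCompactAutomaton_iff.mp h').2.1] at hg
      exact absurd q'.2 hg
    | cons b t =>
      obtain ⟨y, hy⟩ := label_mem_of_mem_edges h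
      obtain ⟨y', hy'⟩ := label_mem_of_mem_edges h'
      obtain rfl : a = b := by
        by_contra hab
        exact hg (p.2.leftQuotient_of_branch hab (by simpa using hy) (by simpa using hy'))
      exact ⟨t, by simp⟩

theorem injOn_originAndFirstLetter_edges :
    Set.InjOn originAndFirstLetter (minimalCompactAutomaton L).edges := by
  rintro ⟨p, v, q⟩ h ⟨p', v', q'⟩ h' heq
  obtain ⟨rfl, hhead⟩ := Prod.mk.inj heq
  obtain ⟨c, v, rfl⟩ := List.exists_cons_of_ne_nil ((minimalCompactAutomaton L).label_ne_nil _ h)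
  obtain ⟨c', v', rfl⟩ :=
    List.exists_cons_of_ne_nil ((minimalCompactAutomaton L).label_ne_nil _ h')
  obtain rfl : c = c' := Option.some.inj hhead
  obtain rfl : v = v' := (label_prefix_label_of_mem_edges h h').eq_of_length_le
    (label_prefix_label_of_mem_edges h' h).length_le
  have hq : q = q' := Subtype.ext ((mem_edges_minimalCompactAutomaton_iff.mp h).2.1.trans
    (mem_edges_minimalCompactAutomaton_iff.mp h').2.1.symm)
  rw [hq]

theorem exists_mem_edges_label_prefix (p : SpecialResidual L)
    (hv : v ≠ []) (hs : IsSpecialResidual L (p.1.leftQuotient v)) :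
    ∃ v' q, v' <+: v ∧ (p, v', q) ∈ (minimalCompactAutomaton L).edges := by
  induction hl : v.length using Nat.strong_induction_on generalizing v with
  | _ l ih =>
    by_cases hmin : ∀ v' v'' : List A, v' ≠ [] → v'' ≠ [] → v = v' ++ v'' →
        ¬ IsSpecialResidual L (p.1.leftQuotient v')
    · exact ⟨v, ⟨_, hs⟩, List.prefix_rfl,
        mem_edges_minimalCompactAutomaton_iff.mpr ⟨hv, rfl, hmin⟩⟩
    · push Not at hmin
      obtain ⟨v', v'', hv', hv'', rfl, hs'⟩ := hmin
      have hlt : v'.length < l := by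
        rw [← hl, List.length_append]
        exact Nat.lt_add_of_pos_right (List.length_pos_iff.mpr hv'')
      obtain ⟨g, q, hg, hedge⟩ := ih v'.length hlt hv' hs' rfl
      exact ⟨g, q, hg.trans (List.prefix_append _ _), hedge⟩

theorem image_originAndFirstLetter_edges :
    originAndFirstLetter '' (minimalCompactAutomaton L).edges =
      Prod.map id some '' {x : SpecialResidual L × A | ∃ t, x.2 :: t ∈ x.1.1} := by
  refine Set.Subset.antisymm ?_ ?_
  · rintro _ ⟨⟨p, v, q⟩, h, rfl⟩
    obtain ⟨c, v, rfl⟩ :=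
      List.exists_cons_of_ne_nil ((minimalCompactAutomaton L).label_ne_nil _ h)
    obtain ⟨t, ht⟩ := label_mem_of_mem_edges h
    exact ⟨(p, c), ⟨v ++ t, ht⟩, rfl⟩
  · rintro _ ⟨⟨p, c⟩, ⟨t, ht⟩, rfl⟩
    obtain ⟨v, q, hv, h⟩ := exists_mem_edges_label_prefix p (List.cons_ne_nil c t)
      (p.2.leftQuotient_of_mem ht)
    obtain ⟨b, v, rfl⟩ :=
      List.exists_cons_of_ne_nil ((minimalCompactAutomaton L).label_ne_nil _ h)
    obtain rfl := (List.cons_prefix_cons.mp hv).1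
    exact ⟨_, h, rfl⟩

theorem numTransitions_minimalCompactAutomaton (L : Language A) :
    (minimalCompactAutomaton L).numTransitions =
      {x : SpecialResidual L × A | ∃ t, x.2 :: t ∈ x.1.1}.encard := by
  rw [CompactAutomaton.numTransitions, ← injOn_originAndFirstLetter_edges.encard_image,
    image_originAndFirstLetter_edges,
    (Function.injective_id.prodMap (Option.some_injective A)).encard_image]

end MinimalCompactAutomaton

section SuffixLanguage

variable {P v x : List A} {a : A} {R : Language A}

theorem mem_leftQuotient_suffixLanguage :
    v ∈ (suffixLanguage P).leftQuotient x ↔ x ++ v <:+ P :=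
  Iff.rfl

theorem exists_cons_mem_leftQuotient_suffixLanguage_iff :
    (∃ t, a :: t ∈ (suffixLanguage P).leftQuotient x) ↔ x ++ [a] <:+: P := by
  constructor
  · rintro ⟨t, s, hs⟩
    exact ⟨s, t, by simpa using hs⟩
  · rintro ⟨s, t, hs⟩
    exact ⟨t, s, by simpa using hs⟩

theorem injOn_leftQuotient_suffixLanguage :
    Set.InjOn (suffixLanguage P).leftQuotient {x | x <+: P} := by
  have length_le : ∀ x ∈ {x | x <+: P}, ∀ y, (suffixLanguage P).leftQuotient x =
      (suffixLanguage P).leftQuotient y → y.length ≤ x.length := by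
    rintro x ⟨v, rfl⟩ y hxy
    have hv : v ∈ (suffixLanguage (x ++ v)).leftQuotient x := List.suffix_rfl
    rw [hxy, mem_leftQuotient_suffixLanguage] at hv
    simpa using hv.length_le
  intro x hx y hy hxy
  exact (List.prefix_of_prefix_length_le hx hy (length_le y hy x hxy.symm)).eq_of_length_le
    (length_le x hx y hxy)

theorem IsEpicentral.exists_leftQuotient_eq (h : IsEpicentral P) (hx : x <:+ P) :
    ∃ T : List A, T.reverse = T ∧ T <+: P ∧
      (suffixLanguage P).leftQuotient x = (suffixLanguage P).leftQuotient T := by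
  obtain ⟨T, hT, hTP, hxT, hext⟩ := h.exists_common_pal_left_extension hx
  refine ⟨T, hT, (prefix_iff_suffix_of_reverse_eq hT h.reverse_eq).mpr hTP, ?_⟩
  ext v
  rw [mem_leftQuotient_suffixLanguage, mem_leftQuotient_suffixLanguage]
  constructor
  · rintro ⟨α, hα⟩
    obtain ⟨s, hs⟩ := hext α ⟨v, by rw [← hα, List.append_assoc]⟩
    exact ⟨s, by rw [← List.append_assoc, hs, ← hα, List.append_assoc]⟩
  · obtain ⟨r, rfl⟩ := hxT
    rw [List.append_assoc]
    exact (List.suffix_append r (x ++ v)).trans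

theorem IsEpicentral.isSpecialResidual_suffixLanguage_iff (h : IsEpicentral P) :
    IsSpecialResidual (suffixLanguage P) R ↔
      ∃ T : List A, T.reverse = T ∧ T <+: P ∧ R = (suffixLanguage P).leftQuotient T := by
  constructor
  · rintro ⟨-, x, rfl, hx⟩
    refine h.exists_leftQuotient_eq ?_
    rcases hx with rfl | hx | ⟨a, b, s, t, hab, ha, hb⟩
    · exact List.nil_suffix
    · exact hx
    · exact h.suffix_of_special hab
        (exists_cons_mem_leftQuotient_suffixLanguage_iff.mp ⟨s, ha⟩)
        (exists_cons_mem_leftQuotient_suffixLanguage_iff.mp ⟨t, hb⟩)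
  · rintro ⟨T, hT, hTP, rfl⟩
    have hTs : T ∈ suffixLanguage P := (prefix_iff_suffix_of_reverse_eq hT h.reverse_eq).mp hTP
    refine ⟨⟨[], ?_⟩, T, rfl, Or.inr (Or.inl hTs)⟩
    rwa [Language.mem_leftQuotient, List.append_nil]

end SuffixLanguage

section CompactSuffixAutomaton

theorem encard_setOf_val_lt {N : ℕ} {f : A → ℕ} (hf : f.support.Finite) (hN : ∀ a, f a ≤ N) :
    {x : Fin N × A | x.1 < f x.2}.encard = ((∑ᶠ a, f a : ℕ) : ℕ∞) := by
  have hset : {x : Fin N × A | x.1 < f x.2} =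
      ↑((Finset.univ ×ˢ hf.toFinset).filter fun x : Fin N × A => x.1 < f x.2) := by
    ext x
    simp only [Set.mem_ofPred_eq, Finset.coe_filter, Finset.mem_product, Finset.mem_univ,
      Set.Finite.mem_toFinset, Function.mem_support, true_and, iff_and_self]
    omega
  rw [hset, Set.encard_coe_eq_coe_finsetCard, Finset.card_filter, Finset.sum_product_right,
    finsum_eq_sum f hf]
  simp only [← Finset.card_filter, Fin.card_filter_val_lt, min_eq_right (hN _)]

variable [DecidableEq A]

/-- The state of the compact suffix automaton of `Pal w` reached by the palindromic prefix
`Pal v`, where `v` is the prefix of `w` of length `k`. -/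
def palState (w : List A) (k : Fin (w.length + 1)) :
    SpecialResidual (suffixLanguage (Pal w)) :=
  ⟨(suffixLanguage (Pal w)).leftQuotient (Pal (w.take k)),
    (isEpicentral_Pal w).isSpecialResidual_suffixLanguage_iff.mpr
      ⟨_, (isEpicentral_Pal _).reverse_eq, Pal_prefix_Pal (List.take_prefix _ _), rfl⟩⟩

theorem palState_injective (w : List A) : Function.Injective (palState w) := by
  intro j k hjk
  have htake (i : Fin (w.length + 1)) : w.take i <+: w := List.take_prefix _ _
  have hPal : Pal (w.take j) = Pal (w.take k) :=
    injOn_leftQuotient_suffixLanguage (Pal_prefix_Pal (htake j)) (Pal_prefix_Pal (htake k))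
      (congrArg Subtype.val hjk)
  have hlen : (w.take j).length = (w.take k).length := le_antisymm
    (prefix_of_length_Pal_le (htake j) (htake k) (by rw [hPal])).length_le
    (prefix_of_length_Pal_le (htake k) (htake j) (by rw [hPal])).length_le
  rw [List.length_take, List.length_take] at hlen
  omega

theorem palState_bijective (w : List A) : Function.Bijective (palState w) := by
  refine ⟨palState_injective w, fun ⟨R, hR⟩ => ?_⟩
  obtain ⟨T, hT, hTP, rfl⟩ := (isEpicentral_Pal w).isSpecialResidual_suffixLanguage_iff.mp hR
  obtain ⟨v, hv, rfl⟩ := exists_prefix_Pal_eq hT hTP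
  refine ⟨⟨v.length, Nat.lt_succ_of_le hv.length_le⟩, Subtype.ext ?_⟩
  change (suffixLanguage (Pal w)).leftQuotient (Pal (w.take v.length)) = _
  rw [← List.prefix_iff_eq_take.mp hv]

theorem exists_cons_mem_palState_iff {w : List A} {k : Fin (w.length + 1)} {a : A} :
    (∃ t, a :: t ∈ (palState w k).1) ↔ k < lastPos a w := by
  have hlen : (w.take k).length = k := by
    rw [List.length_take]
    omega
  rw [← hlen, ← Pal_append_infix_Pal_iff (List.take_prefix _ _)]
  exact exists_cons_mem_leftQuotient_suffixLanguage_iff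

theorem numStates_compactSuffixAutomaton (w : List A) :
    (compactSuffixAutomaton w).numStates = ((w.length + 1 : ℕ) : ℕ∞) := by
  rw [CompactAutomaton.numStates, ← ENat.card_congr (Equiv.ofBijective _ (palState_bijective w))]
  simp

theorem numTransitions_compactSuffixAutomaton (w : List A) :
    (compactSuffixAutomaton w).numTransitions = ((∑ᶠ a : A, lastPos a w : ℕ) : ℕ∞) := by
  have hbij : Function.Bijective (Prod.map (palState w) (id : A → A)) :=
    (palState_bijective w).prodMap Function.bijective_id
  have hpreimage : Prod.map (palState w) id ⁻¹' {x | ∃ t, x.2 :: t ∈ x.1.1} =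
      {x : Fin (w.length + 1) × A | x.1 < lastPos x.2 w} :=
    Set.ext fun _ => exists_cons_mem_palState_iff
  rw [compactSuffixAutomaton, numTransitions_minimalCompactAutomaton,
    ← Set.encard_preimage_of_bijective hbij, hpreimage]
  exact encard_setOf_val_lt (finite_support_lastPos w)
    fun a => (lastPos_le_length a w).trans (Nat.le_succ _)

end CompactSuffixAutomaton

end PalAutomaton

theorem mainTheorem7 {A : Type*} [DecidableEq A] (u : List A) (n : ℕ) (hn : u.length = n) :
    (PalAutomaton.compactSuffixAutomaton u).numStates = ((n + 1 : ℕ) : ℕ∞) ∧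
    (PalAutomaton.compactSuffixAutomaton u).numTransitions =
      ((∑ᶠ a : A, PalAutomaton.lastPos a u : ℕ) : ℕ∞) := by
  subst hn
  exact ⟨PalAutomaton.numStates_compactSuffixAutomaton u,
    PalAutomaton.numTransitions_compactSuffixAutomaton u⟩
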